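/- Let $n$ be a positive integer, and let $B_n$ be the monoid of binary relations on $\{1,\dots,n\}$ under composition, $\xi\eta=\{(i,j):\exists t,\ (i,t)\in\xi,\ (t,j)\in\eta\}$ (equivalently, Boolean $n\times n$ matrices under matrix multiplication). For $1\le i\le n-1$ let $\varepsilon_i\in B_n$ be the union of the identity relation and the graph of the transposition $(i,i+1)$, and let the double Catalan monoid $\mathcal{DC}_n$ be the submonoid of $B_n$ generated by $\varepsilon_1,\dots,\varepsilon_{n-1}$. Then $\mathcal{DC}_n$ has the monoid presentation with generators $f_1,\dots,f_{n-1}$ and defining relations $$f_i^2=f_i\quad(1\le i\le n-1),$$ $$f_if_j=f_jf_i\quad(1\le i,j\le n-1,\ i\neq j\pm1),$$ $$f_if_{i+1}f_i=f_{i+1}f_if_{i+1}\quad(1\le i\le n-2),$$ $$f_if_{i+1}f_{i+2}f_{i+1}f_i=f_if_{i+1}f_{i+2}f_if_{i+1}f_i\quad(1\le i\le n-3),$$ with $f_i$ corresponding to $\varepsilon_i$. That is, the assignment $f_i\mapsto\varepsilon_i$ extends to an isomorphism from the monoid given by this presentation onto $\mathcal{DC}_n$. -/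

import Mathlib

/-- Binary relations on an `n`-element set, indexed by `Fin n` (so the index `k` in
`{1, …, n}` corresponds to `k - 1`). Equivalently, Boolean `n × n` matrices. -/
def BinRel (n : ℕ) : Type := SetRel (Fin n) (Fin n)

namespace BinRel

variable {n : ℕ}

/-- The product `ξ η = {(i, j) | ∃ t, (i, t) ∈ ξ ∧ (t, j) ∈ η}` (the Boolean matrix product),
with the equality relation as identity. -/
instance : Monoid (BinRel n) where
  mul ξ η := SetRel.comp ξ η
  one := SetRel.id
  mul_assoc ξ η ζ := SetRel.comp_assoc ξ η ζ
  one_mul ξ := SetRel.id_comp ξ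
  mul_one ξ := SetRel.comp_id ξ

/-- The semiring sum of two relations: their union (entrywise Boolean sum of matrices). -/
instance : Add (BinRel n) where
  add ξ η := (Set.union ξ η : Set (Fin n × Fin n))

/-- The relation (permutation matrix) `{(i, j) | i = σ j}` of a permutation `σ`. -/
def ofPerm (σ : Equiv.Perm (Fin n)) : BinRel n := {p : Fin n × Fin n | p.1 = σ p.2}

end BinRel

/-- The simple transposition exchanging the positions `i` and `i + 1` (counted from `0`). -/
def simpleTransposition {n : ℕ} (i : Fin (n - 1)) : Equiv.Perm (Fin n) :=
  Equiv.swap ⟨i, by omega⟩ ⟨i + 1, by omega⟩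

/-- `ε i` is the sum of the identity and the `i`-th simple transposition, as relations. -/
def doubleCatalanGen {n : ℕ} (i : Fin (n - 1)) : BinRel n :=
  BinRel.ofPerm 1 + BinRel.ofPerm (simpleTransposition i)

/-- The double Catalan monoid: the submonoid of all binary relations generated by the `ε i`. -/
def DoubleCatalan (n : ℕ) : Submonoid (BinRel n) :=
  Submonoid.closure (Set.range (doubleCatalanGen (n := n)))

/-- The defining relations on the words in the letters `f i`, `i : Fin (n - 1)`. -/
inductive DoubleCatalanRel (n : ℕ) :
    FreeMonoid (Fin (n - 1)) → FreeMonoid (Fin (n - 1)) → Prop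
  | idem (i : Fin (n - 1)) :
      DoubleCatalanRel n (FreeMonoid.of i * FreeMonoid.of i) (FreeMonoid.of i)
  | comm (i j : Fin (n - 1)) (hij : (i : ℕ) ≠ j + 1) (hji : (j : ℕ) ≠ i + 1) :
      DoubleCatalanRel n (FreeMonoid.of i * FreeMonoid.of j) (FreeMonoid.of j * FreeMonoid.of i)
  | braid (i j : Fin (n - 1)) (hj : (j : ℕ) = i + 1) :
      DoubleCatalanRel n (FreeMonoid.of i * FreeMonoid.of j * FreeMonoid.of i)
        (FreeMonoid.of j * FreeMonoid.of i * FreeMonoid.of j)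
  | extra (i j k : Fin (n - 1)) (hj : (j : ℕ) = i + 1) (hk : (k : ℕ) = i + 2) :
      DoubleCatalanRel n
        (FreeMonoid.of i * FreeMonoid.of j * FreeMonoid.of k * FreeMonoid.of j * FreeMonoid.of i)
        (FreeMonoid.of i * FreeMonoid.of j * FreeMonoid.of k * FreeMonoid.of i * FreeMonoid.of j *
          FreeMonoid.of i)

/-! The first three families of relations give the 0-Hecke monoid of the symmetric group: right
multiplication by a generator turns an ascent of an arrangement into a descent and fixes a descent.
So every element is the `arrangementProd` of some arrangement of `Fin n`
(`exists_arrangementProd_eq`). The fourth family identifies `d…c…b…a` with `d…b…c…a` for `a < b < c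
< d` (`arrangementProd_swap_middle`), and in `BinRel n` the product of an arrangement is explicit
(`arrangementProd_gen`). Suppose two arrangements have equal relations and first differ in entries
`y < x`. In the one with `x` at that place, comparing entries of the relations yields a `d > x`
before `x` and an `a < y` after `y`. So `x` and `y` are the middle of a decreasing quadruple, and
exchanging them lengthens the common prefix. By induction the relation determines the product in the
presented monoid, which is injectivity. -/

/-! ### Families satisfying the relations, and products along reduced words. -/

/-- A sequence of elements of a monoid satisfying the defining relations of the double Catalan
monoids, for all indices. -/
structure IsDoubleCatalanFamily {M : Type*} [Monoid M] (f : ℕ → M) : Prop where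
  idem (i : ℕ) : f i * f i = f i
  comm (i j : ℕ) (h : i + 1 < j) : f i * f j = f j * f i
  braid (i : ℕ) : f i * f (i + 1) * f i = f (i + 1) * f i * f (i + 1)
  extra (i : ℕ) : f i * f (i + 1) * f (i + 2) * f (i + 1) * f i =
    f i * f (i + 1) * f (i + 2) * f i * f (i + 1) * f i

/-- The product `f (k + c - 1) * ⋯ * f (k + 1) * f k`. -/
def descendingProd {M : Type*} [Monoid M] (f : ℕ → M) (k : ℕ) : ℕ → M
  | 0 => 1
  | c + 1 => f (k + c) * descendingProd f k c

/-- The product of the `f i` along a reduced word (with letters shifted by `k`) that takes the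
sorted rearrangement of a list to the list itself. -/
def arrangementProd {M α : Type*} [Monoid M] [LinearOrder α] (f : ℕ → M) : ℕ → List α → M
  | _, [] => 1
  | k, x :: l => descendingProd f k (l.countP (· < x)) * arrangementProd f (k + 1) l

/-- This is the boundary case of `extra`, needed once sequences are extended by `1`, so that `f (i +
2) = 1`. -/
theorem mul_mul_mul_mul_of_braid {M : Type*} [Monoid M] {a b : M} (hb : b * b = b)
    (hab : a * b * a = b * a * b) : a * b * b * a = a * b * a * b * a := by
  have h1 : a * b * a * b * a = b * a * b * a := by rw [hab, mul_assoc _ b b, hb]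
  have h2 : b * a * b * a = b * (a * b * a) := by simp only [mul_assoc]
  rw [mul_assoc a, hb, h1, h2, hab, ← mul_assoc, ← mul_assoc, hb]

namespace IsDoubleCatalanFamily

variable {M α : Type*} [Monoid M] [LinearOrder α] {f : ℕ → M}

theorem descendingProd_succ_mul (k c : ℕ) :
    descendingProd f (k + 1) c * f k = descendingProd f k (c + 1) := by
  induction c with
  | zero => simp [descendingProd]
  | succ c ih =>
    rw [descendingProd, mul_assoc, ih, descendingProd.eq_def f k (c + 1 + 1)]
    simp only [add_assoc, add_comm 1 c]

theorem commute_descendingProd_of_lt (hf : IsDoubleCatalanFamily f) {j k : ℕ} (h : j + 1 < k)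
    (c : ℕ) : Commute (f j) (descendingProd f k c) := by
  induction c with
  | zero => exact Commute.one_right _
  | succ c ih => exact Commute.mul_right (hf.comm _ _ (by omega)) ih

theorem commute_descendingProd_of_gt (hf : IsDoubleCatalanFamily f) {j k c : ℕ} (h : k + c < j) :
    Commute (f j) (descendingProd f k c) := by
  induction c with
  | zero => exact Commute.one_right _
  | succ c ih => exact Commute.mul_right (hf.comm _ _ (by omega)).symm (ih (by omega))

/-- `f j` commutes down to the factors `f (j + 1) * f j`. The braid relation there creates an `f (j
+ 1)`, which commutes with all lower factors. -/
theorem mul_descendingProd (hf : IsDoubleCatalanFamily f) {j k c : ℕ} (hk : k ≤ j)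
    (hc : j + 1 < k + c) :
    f j * descendingProd f k c = descendingProd f k c * f (j + 1) := by
  induction c with
  | zero => omega
  | succ c ih =>
    rcases (show j + 1 < k + c ∨ j + 1 = k + c by omega) with h | h
    · rw [descendingProd, mul_assoc, ← ih h, ← mul_assoc, ← mul_assoc, hf.comm _ _ h]
    · obtain ⟨c, rfl⟩ : ∃ c', c = c' + 1 := ⟨c - 1, by omega⟩
      obtain rfl : j = k + c := by omega
      have hcomm := (hf.commute_descendingProd_of_gt (show k + c < k + c + 1 by omega)).eq
      rw [descendingProd, descendingProd, ← add_assoc]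
      simp only [← mul_assoc]
      rw [hf.braid, mul_assoc, hcomm, ← mul_assoc]

theorem descendingProd_mul_descendingProd (hf : IsDoubleCatalanFamily f) (k : ℕ) {c₁ c₂ : ℕ}
    (h : c₁ ≤ c₂) :
    descendingProd f k c₁ * descendingProd f k (c₂ + 1) =
      descendingProd f k (c₂ + 1) * descendingProd f (k + 1) c₁ := by
  induction c₁ with
  | zero => simp [descendingProd]
  | succ c ih =>
    rw [descendingProd, mul_assoc, ih (by omega), ← mul_assoc,
      hf.mul_descendingProd (by omega) (by omega), mul_assoc, descendingProd.eq_def f (k + 1) (c + 1),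
      add_right_comm]

theorem commute_arrangementProd (hf : IsDoubleCatalanFamily f) {j k : ℕ} (h : j + 1 < k)
    (l : List α) : Commute (f j) (arrangementProd f k l) := by
  induction l generalizing k with
  | nil => exact Commute.one_right _
  | cons x l ih =>
    exact Commute.mul_right (hf.commute_descendingProd_of_lt h _) (ih (by omega))

/-- Exchanging two adjacent entries in increasing order multiplies by a generator. -/
theorem arrangementProd_swap (hf : IsDoubleCatalanFamily f) (k : ℕ) (A E : List α) {x y : α}
    (h : x < y) :
    arrangementProd f k (A ++ y :: x :: E) =
      arrangementProd f k (A ++ x :: y :: E) * f (k + A.length) := by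
  induction A generalizing k with
  | nil =>
    have hcount : E.countP (· < x) ≤ E.countP (· < y) :=
      List.countP_mono_left fun z _ hz => by
        simp only [decide_eq_true_eq] at hz ⊢
        exact hz.trans h
    have hcomm := (hf.commute_arrangementProd (show k + 1 < k + 1 + 1 by omega) E).eq
    simp only [List.nil_append, arrangementProd, List.length_nil, add_zero, List.countP_cons, h,
      h.le.not_gt, decide_true, decide_false, if_true, Bool.false_eq_true, if_false, mul_assoc]
    -- The new `f k` moves left past the product of `E` and completes the descending product of `y`.
    rw [← hcomm, ← mul_assoc, ← mul_assoc (descendingProd f (k + 1) _), descendingProd_succ_mul,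
      ← mul_assoc, hf.descendingProd_mul_descendingProd k hcount]
  | cons z A ih =>
    have hperm : (A ++ y :: x :: E).Perm (A ++ x :: y :: E) :=
      (List.Perm.swap x y E).append_left A
    rw [List.cons_append, List.cons_append, arrangementProd, arrangementProd, ih,
      hperm.countP_eq, mul_assoc, List.length_cons,
      add_right_comm, add_assoc k]

theorem arrangementProd_sorted (k : ℕ) (l : List α) (h : l.Pairwise (· ≤ ·)) :
    arrangementProd f k l = 1 := by
  induction l generalizing k with
  | nil => rfl
  | cons x l ih =>
    rw [List.pairwise_cons] at h
    have : l.countP (· < x) = 0 := by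
      rw [List.countP_eq_zero]
      intro y hy
      simpa using h.1 y hy
    rw [arrangementProd, ih _ h.2, this, descendingProd, mul_one]

theorem arrangementProd_swap_congr (hf : IsDoubleCatalanFamily f) {k : ℕ}
    {A A' E E' : List α} {x y u v : α} (hA : A.length = A'.length) (hxy : x < y) (huv : u < v)
    (h : arrangementProd f k (A ++ x :: y :: E) = arrangementProd f k (A' ++ u :: v :: E')) :
    arrangementProd f k (A ++ y :: x :: E) = arrangementProd f k (A' ++ v :: u :: E') := by
  rw [hf.arrangementProd_swap k A E hxy, hf.arrangementProd_swap k A' E' huv, h, hA]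

/-- Moving a small entry right past larger ones only creates inversions, so both sides gain the same
generators. -/
theorem arrangementProd_bubble_small (hf : IsDoubleCatalanFamily f) {k : ℕ} (P : List α)
    {A A' E E' : List α} {y y' : α} (hA : A.length = A'.length) (hy : ∀ p ∈ P, y < p)
    (hy' : ∀ p ∈ P, y' < p)
    (h : arrangementProd f k (A ++ y :: (P ++ E)) = arrangementProd f k (A' ++ y' :: (P ++ E'))) :
    arrangementProd f k (A ++ (P ++ y :: E)) = arrangementProd f k (A' ++ (P ++ y' :: E')) := by
  induction P generalizing A A' with
  | nil => simpa using h
  | cons p P ih =>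
    have h1 := hf.arrangementProd_swap_congr hA (hy p (by simp)) (hy' p (by simp)) h
    have h2 := @ih (A ++ [p]) (A' ++ [p]) (by simp [hA]) (fun q hq => hy q (by simp [hq]))
      (fun q hq => hy' q (by simp [hq])) (by simpa using h1)
    simpa using h2

/-! ### Exchanging the middle of a decreasing quadruple. -/

/-- The two middle entries of four consecutive decreasing entries can be exchanged. -/
theorem arrangementProd_swap_adjacent (hf : IsDoubleCatalanFamily f) (k : ℕ) (A E : List α)
    {a b c d : α} (hab : a < b) (hbc : b < c) (hcd : c < d) :
    arrangementProd f k (A ++ d :: c :: b :: a :: E) =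
      arrangementProd f k (A ++ d :: b :: c :: a :: E) := by
  have s1 (x y z w : α) (h : x < y) := hf.arrangementProd_swap k A (z :: w :: E) h
  have s2 (x y z w : α) (h : y < z) := hf.arrangementProd_swap k (A ++ [x]) (w :: E) h
  have s3 (x y z w : α) (h : z < w) := hf.arrangementProd_swap k (A ++ [x, y]) E h
  simp only [List.append_assoc, List.cons_append, List.nil_append, List.length_append,
    List.length_cons, List.length_nil, zero_add, ← add_assoc] at s1 s2 s3
  have hac := hab.trans hbc
  have hbd := hbc.trans hcd
  have had := hac.trans hcd
  have e := hf.extra (k + A.length)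
  simp only [mul_assoc] at e
  -- Both sides unwind to `A ++ a :: b :: c :: d :: E`, followed by the two words of `extra`.
  rw [s1 _ _ b a hcd, s2 c b d a hbd, s1 _ _ d a hbc, s1 _ _ c a hbd, s2 b c d a hcd,
    s3 b c a d had, s2 b a c d hac, s1 _ _ c d hab]
  simp only [mul_assoc]
  rw [e]

theorem exists_first_le (c : α) (C : List α) :
    (∀ x ∈ C, c < x) ∨ ∃ P e Q, C = P ++ e :: Q ∧ (∀ x ∈ P, c < x) ∧ e ≤ c := by
  induction C with
  | nil => simp
  | cons y C ih =>
    rcases le_or_gt y c with h | h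
    · exact Or.inr ⟨[], y, C, rfl, by simp, h⟩
    · rcases ih with ih | ⟨P, e, Q, rfl, hP, he⟩
      · exact Or.inl (by simpa [h] using ih)
      · exact Or.inr ⟨y :: P, e, Q, rfl, by simpa [h] using hP, he⟩

/-- The last entry `e` of `D` either replaces `a`, if `e ≤ a`, or is exchanged with `a` on both
sides. -/
theorem arrangementProd_swap_contiguous (hf : IsDoubleCatalanFamily f) (k : ℕ) (D : List α)
    (A E : List α) {a b c d : α} (hab : a < b) (hbc : b < c) (hcd : c < d) :
    arrangementProd f k (A ++ d :: c :: b :: (D ++ a :: E)) =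
      arrangementProd f k (A ++ d :: b :: c :: (D ++ a :: E)) := by
  induction D using List.reverseRecOn generalizing a E with
  | nil => exact hf.arrangementProd_swap_adjacent k A E hab hbc hcd
  | append_singleton D e ih =>
    rcases le_or_gt e a with h | h
    · simpa using ih (a :: E) (h.trans_lt hab)
    · have := @arrangementProd_swap_congr M α _ _ f hf k (A ++ d :: c :: b :: D)
        (A ++ d :: b :: c :: D) E E _ _ _ _ (by simp) h h (by simpa using ih (e :: E) hab)
      simpa using this

/-- Mirror argument: the first entry `e` of `B` either replaces `d` or is exchanged with it. -/
theorem arrangementProd_swap_pair (hf : IsDoubleCatalanFamily f) (k : ℕ) (B D : List α)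
    (A E : List α) {a b c d : α} (hab : a < b) (hbc : b < c) (hcd : c < d) :
    arrangementProd f k (A ++ d :: (B ++ c :: b :: (D ++ a :: E))) =
      arrangementProd f k (A ++ d :: (B ++ b :: c :: (D ++ a :: E))) := by
  induction B generalizing A d with
  | nil => exact hf.arrangementProd_swap_contiguous k D A E hab hbc hcd
  | cons e B ih =>
    rcases le_or_gt d e with h | h
    · simpa using ih (A ++ [d]) (hcd.trans_le h)
    · exact hf.arrangementProd_swap_congr rfl h h (by simpa using ih (A ++ [e]) hcd)

/-- The two middle entries of a decreasing subsequence of length four can be exchanged. -/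
theorem arrangementProd_swap_middle (hf : IsDoubleCatalanFamily f) (k : ℕ) (A B C D E : List α)
    {a b c d : α} (hab : a < b) (hbc : b < c) (hcd : c < d) :
    arrangementProd f k (A ++ d :: (B ++ c :: (C ++ b :: (D ++ a :: E)))) =
      arrangementProd f k (A ++ d :: (B ++ b :: (C ++ c :: (D ++ a :: E)))) := by
  induction hn : C.length using Nat.strong_induction_on generalizing A B C D E a b c d with
  | _ n ih =>
    subst hn
    rcases exists_first_le c C with hC | ⟨P, e, Q, rfl, hP, he⟩
    · have h := hf.arrangementProd_swap_pair k B (C ++ D) A E hab hbc hcd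
      -- the entry `c` on the right-hand side moves in parallel with `b` on the left-hand side
      have := @arrangementProd_bubble_small M α _ _ f hf k C (A ++ d :: (B ++ [c]))
        (A ++ d :: (B ++ [b])) (D ++ a :: E) (D ++ a :: E) b c (by simp)
        (fun p hp => hbc.trans (hC p hp)) hC (by simpa using h)
      simpa using this
    · have hlP : P.length < (P ++ e :: Q).length := by simp
      have hlQ : Q.length < (P ++ e :: Q).length := by simp; omega
      rcases lt_or_ge e b with heb | heb
      -- An entry below both `b` and `c` is placed in front of them, which shortens the gap, and is
      -- then moved back on both sides.
      · have h := ih _ (show (P ++ Q).length < (P ++ e :: Q).length by simp) A (B ++ [e]) (P ++ Q) D E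
          hab hbc hcd rfl
        have h1 := @arrangementProd_swap_congr M α _ _ f hf k (A ++ d :: B) (A ++ d :: B)
          (P ++ Q ++ b :: (D ++ a :: E)) (P ++ Q ++ c :: (D ++ a :: E)) e c e b rfl
          (heb.trans hbc) heb (by simpa using h)
        have h2 := @arrangementProd_bubble_small M α _ _ f hf k P (A ++ d :: (B ++ [c]))
          (A ++ d :: (B ++ [b])) (Q ++ b :: (D ++ a :: E)) (Q ++ c :: (D ++ a :: E)) e e (by simp)
          (fun p hp => (heb.trans hbc).trans (hP p hp)) (fun p hp => (heb.trans hbc).trans (hP p hp))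
          (by simpa using h1)
        simpa using h2
      -- For `b ≤ e ≤ c`, the exchange of `c` and `b` is a composite of three exchanges across
      -- shorter gaps.
      · have h1 : arrangementProd f k (A ++ d :: (B ++ c :: (P ++ e :: (Q ++ b :: (D ++ a :: E)))))
            = arrangementProd f k (A ++ d :: (B ++ e :: (P ++ c :: (Q ++ b :: (D ++ a :: E))))) := by
          rcases he.eq_or_lt with rfl | he
          · rfl
          · simpa using ih _ hlP A B P (Q ++ b :: D) E (hab.trans_le heb) he hcd rfl
        have h2 : arrangementProd f k (A ++ d :: (B ++ e :: (P ++ c :: (Q ++ b :: (D ++ a :: E)))))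
            = arrangementProd f k (A ++ d :: (B ++ e :: (P ++ b :: (Q ++ c :: (D ++ a :: E))))) := by
          simpa using ih _ hlQ A (B ++ e :: P) Q D E hab hbc hcd rfl
        have h3 : arrangementProd f k (A ++ d :: (B ++ e :: (P ++ b :: (Q ++ c :: (D ++ a :: E)))))
            = arrangementProd f k (A ++ d :: (B ++ b :: (P ++ e :: (Q ++ c :: (D ++ a :: E))))) := by
          rcases heb.eq_or_lt with rfl | heb
          · rfl
          · simpa using ih _ hlP A B P (Q ++ c :: D) E hab heb (he.trans_lt hcd) rfl
        simpa using h1.trans (h2.trans h3)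

end IsDoubleCatalanFamily
-- The relations hold for Boolean matrices.
namespace BinRel

variable {n : ℕ}

/-- The entry of a relation at a pair of indices. -/
def Holds (X : BinRel n) (i j : Fin n) : Prop := (i, j) ∈ (show Set (Fin n × Fin n) from X)

theorem ext_holds {X Y : BinRel n} (h : ∀ i j, X.Holds i j ↔ Y.Holds i j) : X = Y :=
  Set.ext fun p => h p.1 p.2

theorem holds_mul (X Y : BinRel n) (i j : Fin n) :
    (X * Y).Holds i j ↔ ∃ t, X.Holds i t ∧ Y.Holds t j := Iff.rfl

theorem holds_one (i j : Fin n) : (1 : BinRel n).Holds i j ↔ i = j := Iff.rfl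

theorem holds_gen (k : Fin (n - 1)) (i j : Fin n) :
    (doubleCatalanGen k).Holds i j ↔ i = j ∨ i = simpleTransposition k j := Iff.rfl

/-- The generators as a sequence, extended by the identity relation. -/
def gen (n : ℕ) (k : ℕ) : BinRel n := if h : k < n - 1 then doubleCatalanGen ⟨k, h⟩ else 1

theorem holds_mul_gen (X : BinRel n) (k : ℕ) (hk : k + 1 < n) (i j : Fin n) :
    (X * gen n k).Holds i j ↔
      if (j : ℕ) = k ∨ (j : ℕ) = k + 1 then X.Holds i ⟨k, by omega⟩ ∨ X.Holds i ⟨k + 1, hk⟩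
      else X.Holds i j := by
  have hk' : k < n - 1 := by omega
  rw [holds_mul]
  simp only [gen, hk', dif_pos, holds_gen, simpleTransposition]
  constructor
  · rintro ⟨t, ht, rfl | rfl⟩
    · split_ifs with h
      · rcases h with h | h
        · exact Or.inl (by convert ht; exact h.symm)
        · exact Or.inr (by convert ht; exact h.symm)
      · exact ht
    · rw [Equiv.swap_apply_def] at ht
      simp only [Fin.ext_iff] at ht
      split_ifs at ht ⊢ <;> tauto
  · intro h1
    split_ifs at h1 with h
    · have hj : j = ⟨k, by omega⟩ ∨ j = ⟨k + 1, hk⟩ := by simpa only [Fin.ext_iff] using h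
      rcases hj with rfl | rfl <;> rcases h1 with h1 | h1
      · exact ⟨_, h1, Or.inl rfl⟩
      · exact ⟨_, h1, Or.inr (Equiv.swap_apply_left _ _).symm⟩
      · exact ⟨_, h1, Or.inr (Equiv.swap_apply_right _ _).symm⟩
      · exact ⟨_, h1, Or.inl rfl⟩
    · exact ⟨j, h1, Or.inl rfl⟩

theorem gen_eq_one {k : ℕ} (h : n ≤ k + 1) : gen n k = 1 := dif_neg (by omega)

/-- With an arbitrary left factor, `holds_mul_gen` makes each generator in a word a column
operation. -/
theorem ext_mul_left {X Y : BinRel n} (h : ∀ Z : BinRel n, ∀ i j, (Z * X).Holds i j ↔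
    (Z * Y).Holds i j) : X = Y := by
  simpa using ext_holds (h 1)

theorem gen_idem (n i : ℕ) : gen n i * gen n i = gen n i := by
  rcases lt_or_ge (i + 1) n with h | h
  · refine ext_mul_left fun Z x y => ?_
    simp only [← mul_assoc, holds_mul_gen _ i h]
    split_ifs <;> simp
  · simp [gen_eq_one h]

theorem gen_comm (n : ℕ) {i j : ℕ} (hij : i + 1 < j) : gen n i * gen n j = gen n j * gen n i := by
  rcases lt_or_ge (j + 1) n with h | h
  · have h0 : i + 1 < n := by omega
    refine ext_mul_left fun Z x y => ?_
    simp only [← mul_assoc, holds_mul_gen _ i h0, holds_mul_gen _ j h]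
    split_ifs <;> first | omega | simp_all
  · simp [gen_eq_one h]

theorem gen_braid (n i : ℕ) :
    gen n i * gen n (i + 1) * gen n i = gen n (i + 1) * gen n i * gen n (i + 1) := by
  rcases lt_or_ge (i + 1 + 1) n with h | h
  · have h0 : i + 1 < n := by omega
    have ne (m : ℕ) : i ≠ i + m + 1 := by omega
    have ne' (m : ℕ) : i + m + 1 ≠ i := by omega
    refine ext_mul_left fun Z x y => ?_
    simp only [← mul_assoc, holds_mul_gen _ i h0, holds_mul_gen _ (i + 1) h]
    by_cases h0 : (y : ℕ) = i
    · simp [h0, ne, ne']; tauto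
    by_cases h1 : (y : ℕ) = i + 1
    · simp [h1, ne, ne']; tauto
    by_cases h2 : (y : ℕ) = i + 1 + 1
    · simp [h2, ne, ne']; tauto
    simp [h0, h1, h2]
  · simp [gen_eq_one h, gen_idem]

theorem gen_extra (n i : ℕ) :
    gen n i * gen n (i + 1) * gen n (i + 2) * gen n (i + 1) * gen n i =
      gen n i * gen n (i + 1) * gen n (i + 2) * gen n i * gen n (i + 1) * gen n i := by
  rcases lt_or_ge (i + 2 + 1) n with h | h
  · have hi0 : i + 1 < n := by omega
    have hi1 : i + 1 + 1 < n := by omega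
    have ne (m : ℕ) : i ≠ i + m + 1 := by omega
    have ne' (m : ℕ) : i + m + 1 ≠ i := by omega
    refine ext_mul_left fun Z x y => ?_
    simp only [← mul_assoc, holds_mul_gen _ i hi0, holds_mul_gen _ (i + 1) hi1,
      holds_mul_gen _ (i + 2) h]
    by_cases h0 : (y : ℕ) = i
    · simp [h0, ne, ne']; tauto
    by_cases h1 : (y : ℕ) = i + 1
    · simp [h1, ne, ne']; tauto
    by_cases h2 : (y : ℕ) = i + 2
    · simp [h2, ne, ne']
    by_cases h3 : (y : ℕ) = i + 2 + 1
    · simp [h3, ne']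
    simp [h0, h1, h2, h3]
  · rw [gen_eq_one h, mul_one, mul_mul_mul_mul_of_braid (gen_idem _ _) (gen_braid _ _)]

theorem isDoubleCatalanFamily_gen (n : ℕ) : IsDoubleCatalanFamily (gen n) :=
  ⟨gen_idem n, fun _ _ => gen_comm n, gen_braid n, gen_extra n⟩

end BinRel

/-- Insertion sort run backwards: each step creates one inversion. -/
theorem List.rec_of_swap {α : Type*} [LinearOrder α] {p : List α → Prop}
    (hswap : ∀ A E x y, x < y → p (A ++ x :: y :: E) → p (A ++ y :: x :: E)) (l : List α)
    (h : p (l.insertionSort (· ≤ ·))) : p l := by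
  have insert : ∀ (l : List α) A x, p (A ++ l.orderedInsert (· ≤ ·) x) → p (A ++ x :: l) := by
    intro l
    induction l with
    | nil => simp
    | cons y l ih =>
      intro A x h
      rw [List.orderedInsert_cons] at h
      split_ifs at h with hxy
      · exact h
      · exact hswap A l y x (not_le.1 hxy) (by simpa using ih (A ++ [y]) x (by simpa using h))
  have sort : ∀ (l : List α) A, p (A ++ l.insertionSort (· ≤ ·)) → p (A ++ l) := by
    intro l
    induction l with
    | nil => simp
    | cons y l ih =>
      intro A h
      have h1 := insert _ A y h
      simpa using ih (A ++ [y]) (by rw [List.append_assoc]; exact h1)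
  exact sort l [] h

/-! ### The explicit relation of an arrangement. -/

namespace BinRel

variable {n : ℕ}

/-- The union of the permutation matrices below an arrangement in Bruhat order. -/
def ofArrangement (l : List (Fin n)) : BinRel n :=
  {p : Fin n × Fin n | (∃ x ∈ l.take (p.2 + 1), p.1 ≤ x) ∧ ∃ x ∈ l.drop p.2, x ≤ p.1}

theorem holds_ofArrangement (l : List (Fin n)) (i j : Fin n) : (ofArrangement l).Holds i j ↔
    (∃ x ∈ l.take (j + 1), i ≤ x) ∧ ∃ x ∈ l.drop j, x ≤ i := Iff.rfl

theorem ofArrangement_finRange : ofArrangement (List.finRange n) = 1 := by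
  refine ext_holds fun i j => ?_
  rw [holds_ofArrangement, holds_one]
  simp only [List.mem_take_iff_getElem, List.mem_drop_iff_getElem, List.getElem_finRange]
  constructor
  · rintro ⟨⟨_, ⟨p, hp, rfl⟩, h1⟩, ⟨_, ⟨q, hq, rfl⟩, h2⟩⟩
    simp only [Fin.le_def, Fin.cast_mk] at h1 h2
    ext
    omega
  · rintro rfl
    exact ⟨⟨i, ⟨i, by simp, by simp⟩, le_rfl⟩, i, ⟨0, by simp, by simp⟩, le_rfl⟩

end BinRel

theorem List.mem_take_swap {α : Type*} {A E : List α} {x y z : α} {j : ℕ} (h : j ≠ A.length + 1) :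
    z ∈ (A ++ y :: x :: E).take j ↔ z ∈ (A ++ x :: y :: E).take j := by
  rcases (show j ≤ A.length ∨ ∃ r, j = A.length + (r + 2) by
    rcases le_or_gt j A.length with h1 | h1
    · exact Or.inl h1
    · exact Or.inr ⟨j - A.length - 2, by omega⟩) with h1 | ⟨r, rfl⟩
  · rw [List.take_append_of_le_length h1, List.take_append_of_le_length h1]
  · simp [List.take_append]
    tauto

theorem List.mem_drop_swap {α : Type*} {A E : List α} {x y z : α} {j : ℕ} (h : j ≠ A.length + 1) :
    z ∈ (A ++ y :: x :: E).drop j ↔ z ∈ (A ++ x :: y :: E).drop j := by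
  rcases (show j ≤ A.length ∨ ∃ r, j = A.length + (r + 2) by
    rcases le_or_gt j A.length with h1 | h1
    · exact Or.inl h1
    · exact Or.inr ⟨j - A.length - 2, by omega⟩) with h1 | ⟨r, rfl⟩
  · rw [List.drop_append_of_le_length h1, List.drop_append_of_le_length h1]
    simp
    tauto
  · simp [List.drop_append]

namespace BinRel

theorem ofArrangement_swap {A E : List (Fin n)} {x y : Fin n} (hxy : x < y)
    (hl : (A ++ x :: y :: E).Perm (List.finRange n)) :
    ofArrangement (A ++ y :: x :: E) = ofArrangement (A ++ x :: y :: E) * gen n A.length := by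
  have hlen := hl.length_eq
  simp only [List.length_append, List.length_cons, List.length_finRange] at hlen
  have hk : A.length + 1 < n := by omega
  refine ext_holds fun i j => ?_
  have hi : i ∈ A ++ x :: y :: E := hl.mem_iff.2 (List.mem_finRange i)
  simp only [List.mem_append, List.mem_cons] at hi
  -- This excludes the one bad case: `x < i < y` with nothing `≥ i` in `A` and nothing `≤ i` in `E`.
  replace hi : (∃ z ∈ A, i ≤ z) ∨ i = x ∨ i = y ∨ ∃ z ∈ E, z ≤ i :=
    hi.imp (fun h => ⟨i, h, le_rfl⟩) (Or.imp_right (Or.imp_right fun h => ⟨i, h, le_rfl⟩))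
  rw [holds_mul_gen _ _ hk]
  simp only [holds_ofArrangement]
  have t1 (x : Fin n) (E) : (A ++ x :: E).take (A.length + 1) = A ++ [x] := by
    simp [List.take_append]
  have t2 (x y : Fin n) (E) : (A ++ x :: y :: E).take (A.length + 1 + 1) = A ++ [x, y] := by
    simp [List.take_append, add_assoc]
  have d1 (E : List (Fin n)) : (A ++ E).drop A.length = E := by simp
  have d2 (x : Fin n) (E : List (Fin n)) : (A ++ x :: E).drop (A.length + 1) = E := by
    simp [List.drop_append]
  by_cases h0 : (j : ℕ) = A.length
  · simp only [h0, t1, t2, d1, d2, true_or, if_true, List.mem_append, List.mem_cons,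
      List.not_mem_nil, or_false, or_and_right, exists_or, exists_eq_left]
    generalize (∃ z ∈ A, i ≤ z) = PA at hi ⊢
    generalize (∃ z ∈ E, z ≤ i) = PE at hi ⊢
    clear hl t1 t2 d1 d2
    by_cases PA <;> by_cases PE <;> simp_all <;> omega
  by_cases h1 : (j : ℕ) = A.length + 1
  · simp only [h1, t1, t2, d1, d2, or_true, if_true, List.mem_append, List.mem_cons,
      List.not_mem_nil, or_false, or_and_right, exists_or, exists_eq_left]
    generalize (∃ z ∈ A, i ≤ z) = PA at hi ⊢
    generalize (∃ z ∈ E, z ≤ i) = PE at hi ⊢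
    clear hl t1 t2 d1 d2
    by_cases PA <;> by_cases PE <;> simp_all <;> omega
  · simp only [h0, h1, or_self, if_false, List.mem_drop_swap h1,
      List.mem_take_swap (show (j : ℕ) + 1 ≠ A.length + 1 by omega)]

theorem arrangementProd_gen {l : List (Fin n)} (hl : l.Perm (List.finRange n)) :
    arrangementProd (gen n) 0 l = ofArrangement l := by
  revert hl
  refine List.rec_of_swap (p := fun l => l.Perm (List.finRange n) →
    arrangementProd (gen n) 0 l = ofArrangement l) (fun A E x y hxy ih hl => ?_) l (fun hl => ?_)
  · have hp : (A ++ x :: y :: E).Perm (List.finRange n) :=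
      ((List.Perm.swap y x E).append_left A).trans hl
    rw [(isDoubleCatalanFamily_gen n).arrangementProd_swap 0 A E hxy, ih hp, zero_add,
      ofArrangement_swap hxy hp]
  · have hs : (List.finRange n).Pairwise (· ≤ ·) := by
      exact (List.pairwise_lt_finRange n).imp le_of_lt
    have : l.insertionSort (· ≤ ·) = List.finRange n :=
      hl.eq_of_pairwise (fun a b _ _ => le_antisymm) (List.pairwise_insertionSort _ l) hs
    rw [this, IsDoubleCatalanFamily.arrangementProd_sorted 0 _ hs, ofArrangement_finRange]

end BinRel
-- Arrangements with equal relations.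
theorem List.eq_or_exists_ne {α : Type*} (l l' : List α) (h : l.length = l'.length) :
    l = l' ∨ ∃ A x y L L', x ≠ y ∧ l = A ++ x :: L ∧ l' = A ++ y :: L' := by
  induction l generalizing l' with
  | nil => cases l' <;> simp_all
  | cons a l ih =>
    cases l' with
    | nil => simp at h
    | cons b l' =>
      by_cases hab : a = b
      · subst hab
        rcases ih l' (by simpa using h) with rfl | ⟨A, x, y, L, L', hxy, rfl, rfl⟩
        · exact Or.inl rfl
        · exact Or.inr ⟨a :: A, x, y, L, L', hxy, rfl, rfl⟩
      · exact Or.inr ⟨[], a, b, l, l', hab, rfl, rfl⟩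

namespace BinRel

variable {n : ℕ}

/-- Entries that distinguish two arrangements with the same relation are not left-to-right
maxima. -/
theorem exists_gt_of_ofArrangement_eq {A L L' : List (Fin n)} {x y : Fin n} (hyx : y < x)
    (hl : (A ++ x :: L).Nodup) (hlen : A.length < n)
    (h : ofArrangement (A ++ x :: L) = ofArrangement (A ++ y :: L')) : ∃ d ∈ A, x < d := by
  have h1 : (ofArrangement (A ++ x :: L)).Holds x ⟨A.length, hlen⟩ := by
    rw [holds_ofArrangement]
    exact ⟨⟨x, by simp [List.take_append], le_rfl⟩, x, by simp, le_rfl⟩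
  rw [h, holds_ofArrangement] at h1
  obtain ⟨d, hd, hxd⟩ := h1.1
  have hd' : d ∈ A ∨ d = y := by 
    simpa [List.take_append, List.take_of_length_le (Nat.le_succ A.length)] using hd
  rcases hd' with hd' | rfl
  · refine ⟨d, hd', lt_of_le_of_ne hxd ?_⟩
    rintro rfl
    exact (List.nodup_append.1 hl).2.2 _ hd' _ (by simp) rfl
  · exact absurd hyx hxd.not_gt

/-- An arrangement's own permutation matrix lies in its relation. Transferring the entry of `y` to
the second arrangement gives a smaller entry at position `q + r`; transferring that one back gives
`a`. -/
theorem exists_lt_of_ofArrangement_eq {A P Q L' : List (Fin n)} {x y : Fin n}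
    (hl' : (A ++ y :: L').Nodup) (hlen : (A ++ x :: (P ++ y :: Q)).length = n)
    (hlen' : (A ++ y :: L').length = n)
    (h : ofArrangement (A ++ x :: (P ++ y :: Q)) = ofArrangement (A ++ y :: L')) :
    ∃ a ∈ Q, a < y := by
  set l := A ++ x :: (P ++ y :: Q) with hldef
  have hl0 : l = (A ++ x :: P) ++ y :: Q := by simp [hldef]
  set q := (A ++ x :: P).length with hqdef
  have hq : q < n := by rw [← hlen, hl0]; simp [hqdef]
  have hqA : A.length < q := by simp [hqdef]
  have hself (l : List (Fin n)) (hlen : l.length = n) (p : ℕ) (hp : p < n) :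
      (ofArrangement l).Holds (l[p]'(hlen.symm ▸ hp)) ⟨p, hp⟩ := by
    rw [holds_ofArrangement]
    refine ⟨⟨_, ?_, le_rfl⟩, _, ?_, le_rfl⟩
    · exact List.mem_take_iff_getElem.2 ⟨p, by simp; omega, rfl⟩
    · exact List.mem_drop_iff_getElem.2 ⟨0, by simp; omega, by simp⟩
  have h1 := hself l hlen q hq
  have hy : l[q]'(hlen.symm ▸ hq) = y := by simp [hl0, hqdef]
  rw [hy, h, holds_ofArrangement] at h1
  obtain ⟨a', ha', hle⟩ := h1.2
  obtain ⟨r, hr, rfl⟩ := List.mem_drop_iff_getElem.1 ha'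
  simp only at hr hle
  have hlt := lt_of_le_of_ne hle (by
    have hy' : y = (A ++ y :: L')[A.length]'(by simp) := by simp
    conv_rhs => rw [hy']
    rw [Ne, hl'.getElem_inj_iff]
    omega)
  have h2 := hself _ hlen' (q + r) (by omega)
  rw [← h, holds_ofArrangement] at h2
  obtain ⟨a, ha, hle2⟩ := h2.2
  have ha2 : a ∈ y :: Q := by
    have : l.drop (q + r) <:+ y :: Q := by
      rw [hl0, hqdef, ← List.drop_drop, List.drop_left]
      exact List.drop_suffix _ _
    exact this.subset ha
  have hay : a < y := hle2.trans_lt hlt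
  exact ⟨a, (List.mem_cons.1 ha2).resolve_left hay.ne, hay⟩

end BinRel

namespace IsDoubleCatalanFamily

variable {M : Type*} [Monoid M] {f : ℕ → M} {n : ℕ}

open BinRel

/-- The relation of an arrangement determines the corresponding product in any monoid satisfying
the defining relations. -/
theorem arrangementProd_eq_of_ofArrangement_eq (hf : IsDoubleCatalanFamily f) (A : List (Fin n))
    (L L' : List (Fin n)) (hl : (A ++ L).Perm (List.finRange n))
    (hl' : (A ++ L').Perm (List.finRange n))
    (h : ofArrangement (A ++ L) = ofArrangement (A ++ L')) :
    arrangementProd f 0 (A ++ L) = arrangementProd f 0 (A ++ L') := by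
  induction hm : L.length using Nat.strong_induction_on generalizing A L L' with
  | _ m ih =>
    subst hm
    have hlen : L.length = L'.length := by
      have := hl.length_eq.trans hl'.length_eq.symm
      simpa using this
    -- replace `x` by the smaller entry `y` in the arrangement with the larger entry
    have key : ∀ (B : List (Fin n)) (x y : Fin n) (K K' : List (Fin n)), y < x →
        (B ++ x :: K).Perm (List.finRange n) → (B ++ y :: K').Perm (List.finRange n) →
        ofArrangement (B ++ x :: K) = ofArrangement (B ++ y :: K') → K.length < L.length →
        arrangementProd f 0 (B ++ x :: K) = arrangementProd f 0 (B ++ y :: K') := by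
      intro B x y K K' hyx hp hp' heq hK
      have hnd := hp.nodup_iff.2 (List.nodup_finRange n)
      have hnd' := hp'.nodup_iff.2 (List.nodup_finRange n)
      have hn := hp.length_eq
      have hn' := hp'.length_eq
      rw [List.length_finRange] at hn hn'
      obtain ⟨d, hd, hxd⟩ := exists_gt_of_ofArrangement_eq hyx hnd (by simp at hn; omega) heq
      have hyK : y ∈ K := by
        have h1 : y ∈ B ++ x :: K := hp.mem_iff.2 (List.mem_finRange y)
        simp only [List.mem_append, List.mem_cons, hyx.ne, false_or] at h1
        exact h1.resolve_left fun h2 => (List.nodup_append.1 hnd').2.2 _ h2 _ (by simp) rfl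
      obtain ⟨P, Q, rfl⟩ := List.append_of_mem hyK
      obtain ⟨a, ha, hay⟩ := exists_lt_of_ofArrangement_eq hnd' hn hn' heq
      obtain ⟨Q₁, Q₂, rfl⟩ := List.append_of_mem ha
      obtain ⟨B₁, B₂, rfl⟩ := List.append_of_mem hd
      have hp2 : ((B₁ ++ d :: B₂) ++ y :: (P ++ x :: (Q₁ ++ a :: Q₂))).Perm (List.finRange n) := by
        refine List.Perm.trans (List.Perm.append_left _ ?_) hp
        rw [List.perm_iff_count]
        intro z
        simp only [List.count_cons, List.count_append]
        omega
      have e1 := hf.arrangementProd_swap_middle 0 B₁ B₂ P Q₁ Q₂ hay hyx hxd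
      -- Applied to `gen n`, the same exchange shows that the relation is unchanged, so the
      -- induction hypothesis applies.
      have e2 := (isDoubleCatalanFamily_gen n).arrangementProd_swap_middle 0 B₁ B₂ P Q₁ Q₂ hay hyx hxd
      have e3 : (B₁ ++ d :: B₂) ++ x :: (P ++ y :: (Q₁ ++ a :: Q₂)) =
        B₁ ++ d :: (B₂ ++ x :: (P ++ y :: (Q₁ ++ a :: Q₂))) := by simp
      have e4 : (B₁ ++ d :: B₂) ++ y :: (P ++ x :: (Q₁ ++ a :: Q₂)) =
        B₁ ++ d :: (B₂ ++ y :: (P ++ x :: (Q₁ ++ a :: Q₂))) := by simp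
      rw [← e3, ← e4] at e1 e2
      rw [arrangementProd_gen hp, arrangementProd_gen hp2] at e2
      rw [e1]
      have := ih _ (show (P ++ x :: (Q₁ ++ a :: Q₂)).length < L.length by simpa using hK)
        (B₁ ++ d :: B₂ ++ [y]) (P ++ x :: (Q₁ ++ a :: Q₂)) K' (by simpa using hp2)
        (by simpa using hp') (by simpa using e2.symm.trans heq) rfl
      simpa using this
    rcases List.eq_or_exists_ne L L' hlen with rfl | ⟨B, x, y, K, K', hxy, rfl, rfl⟩
    · rfl
    · simp only [← List.append_assoc] at hl hl' h ⊢
      simp only [List.length_append, List.length_cons] at hlen key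
      rcases lt_or_gt_of_ne hxy with hxy | hxy
      · exact (key (A ++ B) y x K' K hxy hl' hl h.symm (by omega)).symm
      · exact key (A ++ B) x y K K' hxy hl hl' h (by omega)

/-- Every element of the submonoid generated by the first `n - 1` terms is the product of an
arrangement. -/
theorem exists_arrangementProd_eq (hf : IsDoubleCatalanFamily f) {m : M}
    (hm : m ∈ Submonoid.closure (Set.range fun i : Fin (n - 1) => f i)) :
    ∃ l : List (Fin n), l.Perm (List.finRange n) ∧ m = arrangementProd f 0 l := by
  induction hm using Submonoid.closure_induction_right with
  | one =>
    exact ⟨List.finRange n, List.Perm.refl _, (arrangementProd_sorted 0 _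
      ((List.pairwise_lt_finRange n).imp le_of_lt)).symm⟩
  | mul_right m hm y hy ih =>
    obtain ⟨k, rfl⟩ := hy
    obtain ⟨l, hl, hw⟩ := ih
    have hn : l.length = n := by simpa using hl.length_eq
    have hk := k.2
    obtain ⟨A, x, y, E, rfl, hA⟩ : ∃ A x y E, l = A ++ x :: y :: E ∧ A.length = (k : ℕ) := by
      refine ⟨l.take k, l[(k : ℕ)], l[(k : ℕ) + 1], l.drop (k + 2), ?_, ?_⟩
      · rw [List.getElem_cons_drop, List.getElem_cons_drop, List.take_append_drop]
      · simp; omega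
    beta_reduce
    rw [hw, ← hA]
    have hne : x ≠ y := by
      have := hl.nodup_iff.2 (List.nodup_finRange n)
      rw [List.nodup_append] at this
      have := this.2.1
      simp at this
      tauto
    rcases lt_or_gt_of_ne hne with h | h
    · refine ⟨A ++ y :: x :: E, ((List.Perm.swap x y E).append_left A).trans hl, ?_⟩
      rw [hf.arrangementProd_swap 0 A E h, zero_add]
    -- At a descent the generator is already a last factor, and idempotence absorbs it.
    · refine ⟨A ++ x :: y :: E, hl, ?_⟩
      rw [hf.arrangementProd_swap 0 A E h, zero_add, mul_assoc, hf.idem]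

end IsDoubleCatalanFamily
-- The presented monoid and the isomorphism.
/-- The generators of the presented monoid as a sequence, extended by the identity. -/
def presentedGen (n k : ℕ) : PresentedMonoid (DoubleCatalanRel n) :=
  if h : k < n - 1 then PresentedMonoid.of _ ⟨k, h⟩ else 1

theorem presentedGen_fin {n : ℕ} (i : Fin (n - 1)) :
    presentedGen n i = PresentedMonoid.of _ i := dif_pos i.2

theorem presentedGen_eq_one {n k : ℕ} (h : n - 1 ≤ k) : presentedGen n k = 1 := dif_neg h.not_gt

theorem presentedGen_idem (n i : ℕ) : presentedGen n i * presentedGen n i = presentedGen n i := by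
  rcases lt_or_ge i (n - 1) with h | h
  · simpa [presentedGen, PresentedMonoid.of, h] using
      PresentedMonoid.mk_eq_mk_of_rel (DoubleCatalanRel.idem (n := n) ⟨i, h⟩)
  · simp [presentedGen_eq_one h]

theorem presentedGen_braid (n i : ℕ) :
    presentedGen n i * presentedGen n (i + 1) * presentedGen n i =
      presentedGen n (i + 1) * presentedGen n i * presentedGen n (i + 1) := by
  rcases lt_or_ge (i + 1) (n - 1) with h | h
  · have h0 : i < n - 1 := by omega
    simpa [presentedGen, PresentedMonoid.of, h, h0] using
      PresentedMonoid.mk_eq_mk_of_rel (DoubleCatalanRel.braid (n := n) ⟨i, h0⟩ ⟨i + 1, h⟩ rfl)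
  · simp [presentedGen_eq_one h, presentedGen_idem]

theorem isDoubleCatalanFamily_presentedGen (n : ℕ) : IsDoubleCatalanFamily (presentedGen n) where
  idem := presentedGen_idem n
  comm i j hij := by
    rcases lt_or_ge j (n - 1) with h | h
    · have h0 : i < n - 1 := by omega
      simpa [presentedGen, PresentedMonoid.of, h, h0] using PresentedMonoid.mk_eq_mk_of_rel
        (DoubleCatalanRel.comm (n := n) ⟨i, h0⟩ ⟨j, h⟩ (by simp; omega) (by simp; omega))
    · simp [presentedGen_eq_one h]
  braid := presentedGen_braid n
  extra i := by
    rcases lt_or_ge (i + 2) (n - 1) with h | h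
    · have h0 : i < n - 1 := by omega
      have h1 : i + 1 < n - 1 := by omega
      simpa [presentedGen, PresentedMonoid.of, h, h0, h1] using PresentedMonoid.mk_eq_mk_of_rel
        (DoubleCatalanRel.extra (n := n) ⟨i, h0⟩ ⟨i + 1, h1⟩ ⟨i + 2, h⟩ rfl rfl)
    · rw [presentedGen_eq_one h, mul_one,
        mul_mul_mul_mul_of_braid (presentedGen_idem _ _) (presentedGen_braid _ _)]

theorem lift_doubleCatalanGen_rel {n : ℕ} (a b : FreeMonoid (Fin (n - 1)))
    (h : DoubleCatalanRel n a b) :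
    FreeMonoid.lift doubleCatalanGen a = FreeMonoid.lift doubleCatalanGen b := by
  have hg := BinRel.isDoubleCatalanFamily_gen n
  have e (i : Fin (n - 1)) : doubleCatalanGen i = BinRel.gen n i := by
    simp [BinRel.gen]
  cases h with
  | idem i => simpa [e] using hg.idem i
  | comm i j hij hji =>
    simp only [map_mul, FreeMonoid.lift_eval_of, e]
    rcases lt_trichotomy (i : ℕ) j with h | h | h
    · exact hg.comm _ _ (by omega)
    · rw [h]
    · exact (hg.comm _ _ (by omega)).symm
  | braid i j hj => simpa [e, hj] using hg.braid i
  | extra i j k hj hk => simpa [e, hj, hk] using hg.extra i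

/-- The homomorphism from the presented monoid sending the generators to the relations `ε i`. -/
def presentedToBinRel (n : ℕ) : PresentedMonoid (DoubleCatalanRel n) →* BinRel n :=
  PresentedMonoid.lift doubleCatalanGen lift_doubleCatalanGen_rel

theorem presentedToBinRel_gen (n k : ℕ) :
    presentedToBinRel n (presentedGen n k) = BinRel.gen n k := by
  unfold presentedGen BinRel.gen
  split_ifs
  · exact PresentedMonoid.lift_of _ _
  · exact map_one _

theorem map_arrangementProd {M N α : Type*} [Monoid M] [Monoid N] [LinearOrder α] (φ : M →* N)
    (f : ℕ → M) (k : ℕ) (l : List α) :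
    φ (arrangementProd f k l) = arrangementProd (φ ∘ f) k l := by
  have h (k c : ℕ) : φ (descendingProd f k c) = descendingProd (φ ∘ f) k c := by
    induction c with
    | zero => exact map_one φ
    | succ c ih => rw [descendingProd, map_mul, ih]; rfl
  induction l generalizing k with
  | nil => exact map_one φ
  | cons x l ih => rw [arrangementProd, map_mul, ih, h]; rfl

theorem exists_arrangementProd_presentedGen {n : ℕ} (m : PresentedMonoid (DoubleCatalanRel n)) :
    ∃ l : List (Fin n), l.Perm (List.finRange n) ∧ m = arrangementProd (presentedGen n) 0 l := by
  refine (isDoubleCatalanFamily_presentedGen n).exists_arrangementProd_eq ?_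
  simp [presentedGen_fin, PresentedMonoid.closure_range_of]

theorem presentedToBinRel_injective (n : ℕ) : Function.Injective (presentedToBinRel n) := by
  intro m m' h
  obtain ⟨l, hl, rfl⟩ := exists_arrangementProd_presentedGen m
  obtain ⟨l', hl', rfl⟩ := exists_arrangementProd_presentedGen m'
  have hg : presentedToBinRel n ∘ presentedGen n = BinRel.gen n :=
    funext (presentedToBinRel_gen n)
  rw [map_arrangementProd, map_arrangementProd, hg, BinRel.arrangementProd_gen hl,
    BinRel.arrangementProd_gen hl'] at h
  exact (isDoubleCatalanFamily_presentedGen n).arrangementProd_eq_of_ofArrangement_eq [] l l' hl hl' h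

theorem mrange_presentedToBinRel (n : ℕ) :
    MonoidHom.mrange (presentedToBinRel n) = DoubleCatalan n := by
  rw [MonoidHom.mrange_eq_map, ← PresentedMonoid.closure_range_of, MonoidHom.map_mclosure,
    ← Set.range_comp]
  exact congrArg Submonoid.closure (congrArg Set.range (funext fun i =>
    PresentedMonoid.lift_of _ _))

theorem mainTheorem3 (n : ℕ) :
    ∃ e : PresentedMonoid (DoubleCatalanRel n) ≃* DoubleCatalan n,
      ∀ i : Fin (n - 1),
        (e (PresentedMonoid.of (DoubleCatalanRel n) i) : BinRel n) = doubleCatalanGen i := by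
  refine ⟨(MulEquiv.ofLeftInverse' _ (Function.leftInverse_invFun
    (presentedToBinRel_injective n))).trans
      (MulEquiv.submonoidCongr (mrange_presentedToBinRel n)), fun i => ?_⟩
  exact PresentedMonoid.lift_of (x := i) doubleCatalanGen lift_doubleCatalanGen_rel
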